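/- Let $0<X_A\le X_B$ and $0<\underline w\le\overline w$ be fixed. For $n\ge 3$ consider a constant-sum Colonel Blotto game with $n$ battlefields, budgets $X_A,X_B$, battlefield values $w_1,\dots,w_n\in[\underline w,\overline w]$ common to both players, and tie-breaking parameter $\alpha\in[0,1]$. A pure strategy of player $P\in\{A,B\}$ is a vector $x^P\in\mathbb R_{\ge0}^n$ with $\sum_i x_i^P\le X_P$; a mixed strategy is a probability distribution on pure strategies. On battlefield $i$ the player who allocates strictly more gains $w_i$ and the other gains $0$; if the allocations are equal, A gains $\alpha w_i$ and B gains $(1-\alpha)w_i$. Let $\Pi_A(s,t)$, $\Pi_B(s,t)$ be the expected total gains of A and B when they independently play the mixed strategies $s$ and $t$. Put $W=\sum_i w_i$, $v_i^A=v_i^B=v_i=w_i/W$. For $\gamma>0$ let $\Omega(\gamma)=\{i: v_i^A/v_i^B>\gamma\}$, and let $\mathcal S_n$ be the set of all $\gamma>0$ with $$\frac{X_B\gamma}{X_A}=\frac{\gamma^2\sum_{i\in\Omega(\gamma)}\frac{(v_i^B)^2}{v_i^A}+\sum_{i\notin\Omega(\gamma)}v_i^A}{\sum_{i\in\Omega(\gamma)}v_i^B+\frac1{\gamma^2}\sum_{i\notin\Omega(\gamma)}\frac{(v_i^A)^2}{v_i^B}}.$$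 For $\gamma\in\mathcal S_n$ let $$\lambda_A=\frac{\gamma^2}{2X_B}\sum_{i\in\Omega(\gamma)}\frac{(v_i^B)^2}{v_i^A}+\frac1{2X_B}\sum_{i\notin\Omega(\gamma)}v_i^A,\qquad \lambda_B=\frac1{2X_A}\sum_{i\in\Omega(\gamma)}v_i^B+\frac1{2\gamma^2X_A}\sum_{i\notin\Omega(\gamma)}\frac{(v_i^A)^2}{v_i^B},$$ and put $a_i^{\max}=v_i^A/\lambda_A$, $b_i^{\max}=v_i^B/\lambda_B$. Define distributions $F_{A,i}$, $F_{B,i}$ as follows. If $i\in\Omega(\gamma)$, $F_{A,i}$ is uniform on $[0,b_i^{\max}]$ and $F_{B,i}$ has mass $(a_i^{\max}-b_i^{\max})/a_i^{\max}$ at $0$, its remaining mass being uniform on $[0,b_i^{\max}]$. If $i\notin\Omega(\gamma)$, $F_{A,i}$ has mass $(b_i^{\max}-a_i^{\max})/b_i^{\max}$ at $0$, its remaining mass being uniform on $[0,a_i^{\max}]$, and $F_{B,i}$ is uniform on $[0,a_i^{\max}]$. The independently uniform strategy $\mathrm{IU}^{\gamma}_P$ of player $P$ draws $z_i\sim F_{P,i}$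 independently for $i=1,\dots,n$ and allocates $X_P z_i/\sum_j z_j$ to battlefield $i$ (and $0$ to every battlefield if $\sum_j z_j=0$). **Claim.** There is a sequence $\varepsilon(n)>0$ that depends only on $X_A,X_B,\underline w,\overline w$, with $\varepsilon(n)=\tilde{O}(n^{-1/2})$ (i.e. $\varepsilon(n)=O(n^{-1/2}(\ln n)^k)$ for some $k\in\mathbb N$), such that for every $n\ge3$ and every such game: $\mathcal S_n=\{X_B/X_A\}$; and for $\gamma^*\in\mathcal S_n$, $\mathrm{IU}^{\gamma^*}_A$ and $\mathrm{IU}^{\gamma^*}_B$ are mixed strategies of A and B, and for all mixed strategies $\tilde s$ of A and $\tilde t$ of B, $$\inf_t\Pi_A(\tilde s,t)\le\inf_t\Pi_A(\mathrm{IU}^{\gamma^*}_A,t)+\varepsilon(n)W,\qquad \inf_s\Pi_B(s,\tilde t)\le\inf_s\Pi_B(s,\mathrm{IU}^{\gamma^*}_B)+\varepsilon(n)W,$$ where the infima are over all mixed strategies of the opponent. -/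

import Mathlib

noncomputable section

namespace ColonelBlotto

open MeasureTheory

/-- A generalized Colonel Blotto game with `n ≥ 3` battlefields and budgets `0 < XA ≤ XB`:
battlefield `i` is worth `wA i` to Player A and `wB i` to Player B, and `α` is the
tie-breaking parameter. -/
structure Game (n : ℕ) (XA XB : ℝ) where
  wA : Fin n → ℝ
  wB : Fin n → ℝ
  α : ℝ
  three_le : 3 ≤ n
  XA_pos : 0 < XA
  XA_le_XB : XA ≤ XB
  wA_pos : ∀ i, 0 < wA i
  wB_pos : ∀ i, 0 < wB i
  α_nonneg : 0 ≤ α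
  α_le_one : α ≤ 1

/-- The pure strategies with budget `X`. -/
def pureStrategies (n : ℕ) (X : ℝ) : Set (Fin n → ℝ) :=
  {x | (∀ i, 0 ≤ x i) ∧ ∑ i, x i ≤ X}

/-- The mixed strategies with budget `X`: joint distributions of the allocations to all
battlefields that are carried by the pure strategies. -/
def mixedStrategies (n : ℕ) (X : ℝ) : Set (Measure (Fin n → ℝ)) :=
  {μ | IsProbabilityMeasure μ ∧ ∀ᵐ x ∂μ, x ∈ pureStrategies n X}

/-- The uniform distribution on `[0, m]`. -/
def uniformDist (m : ℝ) : Measure ℝ :=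
  ProbabilityTheory.cond volume (Set.Icc 0 m)

/-- The distribution with mass `p` at `0` whose remaining mass `1 - p` is uniform on `[0, m]`;
its distribution function is `p + (1 - p) * x / m` on `[0, m]`. -/
def atomUniformDist (p m : ℝ) : Measure ℝ :=
  ENNReal.ofReal p • Measure.dirac 0 + ENNReal.ofReal (1 - p) • uniformDist m

/-- Rescaling of a vector of draws to total `X` (the zero allocation if the draws sum to `0`). -/
def rescale {n : ℕ} (X : ℝ) (a : Fin n → ℝ) : Fin n → ℝ :=
  fun i => if ∑ j, a j = 0 then 0 else a i / (∑ j, a j) * X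

/-- `f = Õ(g)`: big-O up to a power of the logarithm. -/
def IsSoftO (f g : ℕ → ℝ) : Prop :=
  ∃ k : ℕ, Asymptotics.IsBigO Filter.atTop f (fun n => g n * Real.log (n : ℝ) ^ k)

namespace Game

variable {n : ℕ} {XA XB : ℝ} (G : Game n XA XB)

/-- The Blotto function of Player A. -/
def betaA (x y : ℝ) : ℝ := if y < x then 1 else if x = y then G.α else 0

/-- The Blotto function of Player B. -/
def betaB (x y : ℝ) : ℝ := if x < y then 1 else if y = x then 1 - G.α else 0

/-- Payoff of Player A under pure strategies. -/
def payoffA (x y : Fin n → ℝ) : ℝ := ∑ i, G.wA i * G.betaA (x i) (y i)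

/-- Payoff of Player B under pure strategies. -/
def payoffB (x y : Fin n → ℝ) : ℝ := ∑ i, G.wB i * G.betaB (x i) (y i)

/-- Expected payoff of Player A when A and B independently play `s` and `t`. -/
def mixedPayoffA (s t : Measure (Fin n → ℝ)) : ℝ := ∫ p, G.payoffA p.1 p.2 ∂(s.prod t)

/-- Expected payoff of Player B when A and B independently play `s` and `t`. -/
def mixedPayoffB (s t : Measure (Fin n → ℝ)) : ℝ := ∫ p, G.payoffB p.1 p.2 ∂(s.prod t)

/-- Worst-case payoff of Player A when she plays `s`. -/
def worstCaseA (s : Measure (Fin n → ℝ)) : ℝ := ⨅ t : mixedStrategies n XB, G.mixedPayoffA s t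

/-- Worst-case payoff of Player B when she plays `t`. -/
def worstCaseB (t : Measure (Fin n → ℝ)) : ℝ := ⨅ s : mixedStrategies n XA, G.mixedPayoffB s t

def WA : ℝ := ∑ i, G.wA i

def WB : ℝ := ∑ i, G.wB i

def W : ℝ := max G.WA G.WB

/-- Normalized battlefield values. -/
def vA (i : Fin n) : ℝ := G.wA i / G.WA

def vB (i : Fin n) : ℝ := G.wB i / G.WB

/-- The two players value every battlefield equally. -/
def IsConstantSum : Prop := ∀ i, G.wA i = G.wB i

/-- All battlefield values lie in `[wlo, whi]`. -/
def ValuesIn (wlo whi : ℝ) : Prop :=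
  ∀ i, (wlo ≤ G.wA i ∧ G.wA i ≤ whi) ∧ (wlo ≤ G.wB i ∧ G.wB i ≤ whi)

open Classical in
/-- The battlefields `i` with `vA i / vB i > γ`. -/
def OmegaA (γ : ℝ) : Finset (Fin n) := Finset.univ.filter fun i => γ < G.vA i / G.vB i

/-- The positive solutions `γ` of the equation that determines the multipliers. -/
def solutionSet : Set ℝ :=
  {γ | 0 < γ ∧
    XB * γ / XA =
      (γ ^ 2 * ∑ i ∈ G.OmegaA γ, G.vB i ^ 2 / G.vA i + ∑ i ∈ (G.OmegaA γ)ᶜ, G.vA i) /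
      (∑ i ∈ G.OmegaA γ, G.vB i + 1 / γ ^ 2 * ∑ i ∈ (G.OmegaA γ)ᶜ, G.vA i ^ 2 / G.vB i)}

def lambdaA (γ : ℝ) : ℝ :=
  γ ^ 2 / (2 * XB) * ∑ i ∈ G.OmegaA γ, G.vB i ^ 2 / G.vA i +
    1 / (2 * XB) * ∑ i ∈ (G.OmegaA γ)ᶜ, G.vA i

def lambdaB (γ : ℝ) : ℝ :=
  1 / (2 * XA) * ∑ i ∈ G.OmegaA γ, G.vB i +
    1 / (2 * γ ^ 2 * XA) * ∑ i ∈ (G.OmegaA γ)ᶜ, G.vA i ^ 2 / G.vB i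

/-- The uniform-type distribution from which Player A draws on battlefield `i`. -/
def distA (γ : ℝ) (i : Fin n) : Measure ℝ :=
  if i ∈ G.OmegaA γ then uniformDist (G.vB i / G.lambdaB γ)
  else atomUniformDist
    ((G.vB i / G.lambdaB γ - G.vA i / G.lambdaA γ) / (G.vB i / G.lambdaB γ))
    (G.vA i / G.lambdaA γ)

/-- The uniform-type distribution from which Player B draws on battlefield `i`. -/
def distB (γ : ℝ) (i : Fin n) : Measure ℝ :=
  if i ∈ G.OmegaA γ then atomUniformDist
    ((G.vA i / G.lambdaA γ - G.vB i / G.lambdaB γ) / (G.vA i / G.lambdaA γ))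
    (G.vB i / G.lambdaB γ)
  else uniformDist (G.vA i / G.lambdaA γ)

/-- The independently uniform strategy of Player A: draw independently from the uniform-type
distributions, then rescale to the budget. -/
def IUA (γ : ℝ) : Measure (Fin n → ℝ) := (Measure.pi (G.distA γ)).map (rescale XA)

/-- The independently uniform strategy of Player B. -/
def IUB (γ : ℝ) : Measure (Fin n → ℝ) := (Measure.pi (G.distB γ)).map (rescale XB)

end Game

end ColonelBlotto

end

/-! With common values every ratio `vA i / vB i` is 1, so `OmegaA γ` is everything or empty; in both
cases the equation reduces to `XB / XA * γ = γ ^ 2`, and `XB / XA ≥ 1` selects the empty case. At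
this `γ` both players draw from one family: mass `1 - p` at 0 and the rest uniform on `[0, 2 * XB *
v i]`, with `p = XA / XB` for A and `p = 1` for B. The mean total of the draws is then exactly the
budget `p * XB`.

Rescaling barely raises the distribution function of a coordinate
(`map_rescale_atomUniformDist_real_le`). A rescaled coordinate is at most `y` only if the draw is at
most `y / (X - y)` times the independent sum of the other draws. The distribution function of the
draw has an affine upper bound, so only the mean of that sum matters and no concentration inequality
is needed. The error is of order `v i`, hence `O(1/n)`, which beats the required rate.

The affine bound, weighted by `wA i` and summed, depends on the opponent's allocation only through
its total. Hence A guarantees herself `WA * XA / (2 * XB)` up to a small error, and B holds A to the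
same amount up to a small error. As the game is constant-sum, no strategy of either player can
guarantee noticeably more. -/

namespace ColonelBlotto

open MeasureTheory ProbabilityTheory

/-! ### Uniform laws with and without an atom at zero -/

section UniformDist

variable {m : ℝ}

theorem isProbabilityMeasure_uniformDist (hm : 0 < m) :
    IsProbabilityMeasure (uniformDist m) :=
  cond_isProbabilityMeasure_of_finite (by simpa using hm) (by simp)

/-- The bound is not capped at 1: being affine on the whole half-line, it can be integrated against
an unbounded threshold. -/
theorem uniformDist_real_Iic_le (hm : 0 < m) {z : ℝ} (hz : 0 ≤ z) :
    (uniformDist m).real (Set.Iic z) ≤ z / m := by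
  have hsub : Set.Icc 0 m ∩ Set.Iic z ⊆ Set.Icc 0 z := fun x hx => ⟨hx.1.1, hx.2⟩
  have hle : volume.real (Set.Icc 0 m ∩ Set.Iic z) ≤ z := by
    refine (measureReal_mono hsub (by simp)).trans ?_
    simp [hz]
  rw [uniformDist, Measure.real, cond_apply measurableSet_Icc, ENNReal.toReal_mul,
    ENNReal.toReal_inv, Real.volume_Icc, sub_zero, ENNReal.toReal_ofReal hm.le, div_eq_inv_mul]
  exact mul_le_mul_of_nonneg_left hle (by positivity)

theorem ae_uniformDist_mem_Icc (m : ℝ) : ∀ᵐ x ∂uniformDist m, x ∈ Set.Icc 0 m :=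
  ae_cond_mem measurableSet_Icc

theorem integral_uniformDist (hm : 0 < m) : ∫ x, x ∂uniformDist m = m / 2 := by
  rw [uniformDist, ProbabilityTheory.cond, integral_smul_measure, integral_Icc_eq_integral_Ioc,
    ← intervalIntegral.integral_of_le hm.le, integral_id]
  simp [hm.le]
  field_simp

theorem integrable_uniformDist (hm : 0 < m) : Integrable (fun x => x) (uniformDist m) := by
  have := isProbabilityMeasure_uniformDist hm
  refine Integrable.of_bound (by fun_prop) m ?_
  filter_upwards [ae_uniformDist_mem_Icc m] with x hx
  rw [Real.norm_eq_abs, abs_of_nonneg hx.1]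
  exact hx.2

end UniformDist

section AtomUniformDist

variable {q m : ℝ}

theorem isProbabilityMeasure_atomUniformDist (hq : 0 ≤ q) (hq1 : q ≤ 1) (hm : 0 < m) :
    IsProbabilityMeasure (atomUniformDist q m) := by
  have := isProbabilityMeasure_uniformDist hm
  constructor
  simp [atomUniformDist, ← ENNReal.ofReal_add hq (sub_nonneg.2 hq1)]

theorem atomUniformDist_zero (m : ℝ) : atomUniformDist 0 m = uniformDist m := by
  simp [atomUniformDist]

theorem atomUniformDist_real_Iic_le (hq : 0 ≤ q) (hq1 : q ≤ 1) (hm : 0 < m) {z : ℝ}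
    (hz : 0 ≤ z) : (atomUniformDist q m).real (Set.Iic z) ≤ q + (1 - q) * (z / m) := by
  have := isProbabilityMeasure_uniformDist hm
  have h1 : 0 ≤ 1 - q := sub_nonneg.2 hq1
  have hf (μ : Measure ℝ) [IsProbabilityMeasure μ] (t : ℝ) :
      (ENNReal.ofReal t • μ) (Set.Iic z) ≠ ⊤ := by
    rw [Measure.smul_apply, smul_eq_mul]
    exact ENNReal.mul_ne_top ENNReal.ofReal_ne_top (measure_ne_top _ _)
  rw [atomUniformDist, measureReal_add_apply (h₁ := hf _ _) (h₂ := hf _ _),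
    measureReal_ennreal_smul_apply, measureReal_ennreal_smul_apply, ENNReal.toReal_ofReal hq, ENNReal.toReal_ofReal h1]
  gcongr
  · exact mul_le_of_le_one_right hq measureReal_le_one
  · exact uniformDist_real_Iic_le hm hz

theorem ae_atomUniformDist_mem_Icc (q : ℝ) (hm : 0 < m) :
    ∀ᵐ x ∂atomUniformDist q m, x ∈ Set.Icc 0 m := by
  rw [atomUniformDist, ae_add_measure_iff]
  refine ⟨Measure.ae_smul_measure ?_ _, Measure.ae_smul_measure (ae_uniformDist_mem_Icc m) _⟩
  exact (ae_dirac_iff (p := (· ∈ Set.Icc 0 m)) measurableSet_Icc).2 ⟨le_rfl, hm.le⟩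

theorem integrable_atomUniformDist (q : ℝ) (hm : 0 < m) :
    Integrable (fun x => x) (atomUniformDist q m) := by
  refine Integrable.add_measure ?_ ?_
  · exact (integrable_dirac (by simp)).smul_measure (by simp)
  · exact (integrable_uniformDist hm).smul_measure (by simp)

theorem integral_atomUniformDist (hq1 : q ≤ 1) (hm : 0 < m) :
    ∫ x, x ∂atomUniformDist q m = (1 - q) * (m / 2) := by
  rw [atomUniformDist, integral_add_measure, integral_smul_measure, integral_smul_measure,
    integral_uniformDist hm, ENNReal.toReal_ofReal (sub_nonneg.2 hq1)]
  · simp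
  · exact (integrable_dirac (by simp)).smul_measure (by simp)
  · exact (integrable_uniformDist hm).smul_measure (by simp)

end AtomUniformDist

/-- If the distribution function of `μ` is bounded on `[0, ∞)` by an affine function, then so is
the probability that a `μ`-variable is at most a multiple of an independent nonnegative one. -/
theorem prod_real_le_of_affine_cdf {μ ν : Measure ℝ} [IsProbabilityMeasure μ]
    [IsProbabilityMeasure ν] {q k c : ℝ} (hc : 0 ≤ c)
    (hμ : ∀ z, 0 ≤ z → μ.real (Set.Iic z) ≤ q + k * z)
    (hν : ∀ᵐ z ∂ν, 0 ≤ z) (hint : Integrable (fun z => z) ν) :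
    (μ.prod ν).real {p | p.1 ≤ c * p.2} ≤ q + k * c * ∫ z, z ∂ν := by
  have hs : MeasurableSet {p : ℝ × ℝ | p.1 ≤ c * p.2} :=
    measurableSet_le measurable_fst (by fun_prop)
  have hm : Measurable fun z : ℝ => μ (Set.Iic (c * z)) := measurable_measure_prodMk_right hs
  have hi : Integrable (fun z => μ.real (Set.Iic (c * z))) ν := by
    refine Integrable.of_bound hm.ennreal_toReal.aestronglyMeasurable 1 (.of_forall fun z => ?_)
    rw [Real.norm_eq_abs, abs_of_nonneg measureReal_nonneg]
    exact measureReal_le_one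
  -- Condition on the second variable; the affine bound then integrates to an expression in its mean
  -- alone.
  have heq : (μ.prod ν).real {p | p.1 ≤ c * p.2} = ∫ z, μ.real (Set.Iic (c * z)) ∂ν := by
    rw [Measure.real, Measure.prod_apply_symm hs]
    exact (integral_toReal hm.aemeasurable (.of_forall fun z => measure_lt_top _ _)).symm
  rw [heq]
  calc ∫ z, μ.real (Set.Iic (c * z)) ∂ν ≤ ∫ z, (q + k * c * z) ∂ν := by
        refine integral_mono_ae hi ((integrable_const _).add (hint.const_mul _)) ?_
        filter_upwards [hν] with z hz
        rw [mul_assoc]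
        exact hμ _ (mul_nonneg hc hz)
    _ = q + k * c * ∫ z, z ∂ν := by
        rw [integral_add (integrable_const _) (hint.const_mul _), integral_const_mul]
        simp

/-! ### Rescaling to the budget -/

theorem measurable_rescale {n : ℕ} (X : ℝ) : Measurable (rescale (n := n) X) := by
  refine measurable_pi_lambda _ fun i => ?_
  refine Measurable.ite ?_ measurable_const (by fun_prop)
  exact measurableSet_eq_fun (by fun_prop) measurable_const

theorem measurableSet_pureStrategies (n : ℕ) (X : ℝ) : MeasurableSet (pureStrategies n X) := by
  refine MeasurableSet.inter ?_ (measurableSet_le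
    (f := fun x : Fin n → ℝ => ∑ i, x i) (by fun_prop) measurable_const)
  have h : {x : Fin n → ℝ | ∀ i, 0 ≤ x i} = ⋂ i, {x | 0 ≤ x i} := by
    ext
    simp
  change MeasurableSet {x : Fin n → ℝ | ∀ i, 0 ≤ x i}
  rw [h]
  exact MeasurableSet.iInter fun i => measurableSet_le measurable_const (measurable_pi_apply i)

theorem rescale_mem_pureStrategies {n : ℕ} {X : ℝ} (hX : 0 ≤ X) {a : Fin n → ℝ}
    (ha : ∀ i, 0 ≤ a i) : rescale X a ∈ pureStrategies n X := by
  have hs : 0 ≤ ∑ j, a j := Finset.sum_nonneg fun j _ => ha j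
  by_cases h : ∑ j, a j = 0
  · simp [rescale, pureStrategies, h, hX]
  · refine ⟨fun i => ?_, ?_⟩
    · simp only [rescale, h, if_false]
      have := ha i
      positivity
    · simp only [rescale, h, if_false]
      rw [← Finset.sum_mul, ← Finset.sum_div, div_self h, one_mul]

/-- A rescaled coordinate is small only if the coordinate is small against the sum of the
others. -/
theorem le_of_rescale_le {n : ℕ} {X y : ℝ} (hy : y < X) {a : Fin n → ℝ}
    (ha : ∀ i, 0 ≤ a i) {i : Fin n} (h : rescale X a i ≤ y) :
    a i ≤ y / (X - y) * ∑ j ∈ Finset.univ.erase i, a j := by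
  have hs : 0 ≤ ∑ j, a j := Finset.sum_nonneg fun j _ => ha j
  have hXy : 0 < X - y := sub_pos.2 hy
  have hsplit : a i + ∑ j ∈ Finset.univ.erase i, a j = ∑ j, a j :=
    Finset.add_sum_erase _ _ (Finset.mem_univ i)
  rw [div_mul_eq_mul_div, le_div_iff₀ hXy]
  by_cases h0 : ∑ j, a j = 0
  · have h0' := (Finset.sum_eq_zero_iff_of_nonneg fun j _ => ha j).1 h0
    rw [Finset.sum_eq_zero fun j _ => h0' j (Finset.mem_univ j), h0' i (Finset.mem_univ i)]
    simp
  · have hpos : 0 < ∑ j, a j := lt_of_le_of_ne hs (Ne.symm h0)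
    simp only [rescale, h0, if_false] at h
    rw [div_mul_eq_mul_div, div_le_iff₀ hpos] at h
    rw [← hsplit] at h
    linarith

/-! ### Rescaled independent draws -/

section IndependentDraws

variable {n : ℕ} {μ : Fin n → Measure ℝ} [∀ i, IsProbabilityMeasure (μ i)]

/-- Independence of one draw from the sum of the others. This is why the threshold is written with
the sum omitting `i` rather than the full sum. -/
theorem map_eval_sum_erase_pi (i : Fin n) :
    (Measure.pi μ).map (fun a => (a i, ∑ j ∈ Finset.univ.erase i, a j)) =
      (μ i).prod ((Measure.pi μ).map fun a => ∑ j ∈ Finset.univ.erase i, a j) := by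
  have hind : iIndepFun (fun (j : Fin n) (a : Fin n → ℝ) => a j) (Measure.pi μ) :=
    iIndepFun_pi (X := fun _ => id) fun _ => aemeasurable_id
  have h := (hind.indepFun_finsetSum_of_notMem (fun j => measurable_pi_apply j)
    (Finset.notMem_erase i Finset.univ)).symm
  have he : (∑ j ∈ Finset.univ.erase i, fun a : Fin n → ℝ => a j) =
      fun a => ∑ j ∈ Finset.univ.erase i, a j := by
    ext a
    simp
  rw [he] at h
  rw [h.map_prod_eq_prod_map_map (measurable_pi_apply i).aemeasurable
    (by fun_prop), (measurePreserving_eval μ i).map_eq]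

theorem ae_pi_nonneg (hμ : ∀ i, ∀ᵐ x ∂μ i, 0 ≤ x) : ∀ᵐ a ∂Measure.pi μ, ∀ i, 0 ≤ a i :=
  ae_all_iff.2 fun i => Measure.tendsto_eval_ae_ae.eventually (hμ i)

theorem map_rescale_mem_mixedStrategies {X : ℝ} (hX : 0 ≤ X) (hμ : ∀ i, ∀ᵐ x ∂μ i, 0 ≤ x) :
    (Measure.pi μ).map (rescale X) ∈ mixedStrategies n X := by
  refine ⟨Measure.isProbabilityMeasure_map (measurable_rescale X).aemeasurable, ?_⟩
  refine (ae_map_iff (p := (· ∈ pureStrategies n X)) (measurable_rescale X).aemeasurable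
    (measurableSet_pureStrategies n X)).2 ?_
  filter_upwards [ae_pi_nonneg hμ] with a ha
  exact rescale_mem_pureStrategies hX ha

/-- The event is contained in a comparison of the draw with a multiple of the independent remaining
sum, so the affine bound on the draw applies with that sum replaced by its mean. -/
theorem map_rescale_real_le {X q k y : ℝ} (hy : 0 ≤ y) (hyX : y < X) (i : Fin n)
    (hμ : ∀ j, ∀ᵐ x ∂μ j, 0 ≤ x) (hint : ∀ j, Integrable (fun x => x) (μ j))
    (hcdf : ∀ z, 0 ≤ z → (μ i).real (Set.Iic z) ≤ q + k * z) :
    ((Measure.pi μ).map (rescale X)).real {x | x i ≤ y} ≤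
      q + k * (y / (X - y)) * ∑ j ∈ Finset.univ.erase i, ∫ x, x ∂μ j := by
  have hae := ae_pi_nonneg hμ
  have hi : ∀ j, Integrable (fun a : Fin n → ℝ => a j) (Measure.pi μ) := fun j =>
    integrable_comp_eval (μ := μ) (i := j) (f := fun x : ℝ => x) (hint j)
  have hsm : Measurable fun a : Fin n → ℝ => ∑ j ∈ Finset.univ.erase i, a j := by fun_prop
  have := Measure.isProbabilityMeasure_map (μ := Measure.pi μ) hsm.aemeasurable
  have hmean : ∫ z, z ∂((Measure.pi μ).map fun a => ∑ j ∈ Finset.univ.erase i, a j) =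
      ∑ j ∈ Finset.univ.erase i, ∫ x, x ∂μ j := by
    rw [integral_map hsm.aemeasurable (by fun_prop), integral_finsetSum _ fun j _ => hi j]
    exact Finset.sum_congr rfl fun j _ =>
      integral_comp_eval (μ := μ) (i := j) (f := fun x : ℝ => x) (by fun_prop)
  have hset : MeasurableSet {p : ℝ × ℝ | p.1 ≤ y / (X - y) * p.2} :=
    measurableSet_le measurable_fst (by fun_prop)
  rw [map_measureReal_apply (measurable_rescale X)
    (measurableSet_le (measurable_pi_apply i) measurable_const), ← hmean]
  refine le_trans ?_ (prod_real_le_of_affine_cdf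
    (div_nonneg hy (sub_nonneg.2 hyX.le)) hcdf ?_ ?_)
  · rw [← map_eval_sum_erase_pi, map_measureReal_apply (by fun_prop) hset]
    refine ENNReal.toReal_mono (measure_ne_top _ _) (measure_mono_ae ?_)
    filter_upwards [hae] with a ha h
    exact le_of_rescale_le hyX ha h
  · rw [ae_map_iff hsm.aemeasurable measurableSet_Ici]
    filter_upwards [hae] with a ha
    exact Finset.sum_nonneg fun j _ => ha j
  · exact (integrable_map_measure (by fun_prop) hsm.aemeasurable).2
      (integrable_finsetSum _ fun j _ => hi j)

end IndependentDraws

/-- Independent draws from atom-uniform distributions with the proportions `v`, rescaled to the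
expected total: the distribution function of a coordinate is at most that of the draw itself, up
to an error proportional to `v i`. -/
theorem map_rescale_atomUniformDist_real_le {n : ℕ} {v : Fin n → ℝ} (hv : ∀ i, 0 < v i)
    (hv1 : ∑ i, v i = 1) {p XB : ℝ} (hp : 0 < p) (hp1 : p ≤ 1) (hXB : 0 < XB) (i : Fin n)
    {y : ℝ} (hy : 0 ≤ y) :
    ((Measure.pi fun j => atomUniformDist (1 - p) (2 * XB * v j)).map (rescale (p * XB))).real
      {x | x i ≤ y} ≤ 1 - p + p * (y / (2 * XB * v i)) + 4 * v i / p := by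
  have hm : ∀ j, 0 < 2 * XB * v j := fun j => by have := hv j; positivity
  have hP : ∀ j, IsProbabilityMeasure (atomUniformDist (1 - p) (2 * XB * v j)) := fun j =>
    isProbabilityMeasure_atomUniformDist (by linarith) (by linarith) (hm j)
  have hvi := hv i
  have hprob := Measure.isProbabilityMeasure_map
    (μ := Measure.pi fun j => atomUniformDist (1 - p) (2 * XB * v j))
    (measurable_rescale (n := n) (p * XB)).aemeasurable
  have herr : 0 ≤ 4 * v i / p := by positivity
  rcases le_or_gt 1 (y / (2 * XB * v i)) with hu | hu
  · refine measureReal_le_one.trans ?_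
    nlinarith
  have hu0 : 0 ≤ y / (2 * XB * v i) := div_nonneg hy (hm i).le
  -- If `p ≤ 4 * v i`, the error term alone is at least 1. Otherwise `y < 2 * XB * v i` is below
  -- half the budget, which keeps `p * XB - y` away from 0.
  rcases le_or_gt p (4 * v i) with hvp | hvp
  · refine measureReal_le_one.trans ?_
    have : 1 ≤ 4 * v i / p := (one_le_div hp).2 hvp
    nlinarith
  have hy2 : y < 2 * XB * v i := (div_lt_one (hm i)).1 hu
  have hyX : 2 * y < p * XB := by nlinarith
  refine (map_rescale_real_le (q := 1 - p) (k := p / (2 * XB * v i)) hy (by linarith) i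
    (fun j => (ae_atomUniformDist_mem_Icc _ (hm j)).mono fun x hx => hx.1)
    (fun j => integrable_atomUniformDist _ (hm j)) fun z hz => ?_).trans ?_
  · refine (atomUniformDist_real_Iic_le (by linarith) (by linarith) (hm i) hz).trans (le_of_eq ?_)
    ring
  have hsum : ∑ j ∈ Finset.univ.erase i, ∫ x, x ∂atomUniformDist (1 - p) (2 * XB * v j) =
      p * XB * (1 - v i) := by
    have hrest : 1 - v i = ∑ j ∈ Finset.univ.erase i, v j := by
      rw [← hv1, ← Finset.add_sum_erase _ _ (Finset.mem_univ i), add_sub_cancel_left]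
    rw [hrest, Finset.mul_sum]
    refine Finset.sum_congr rfl fun j _ => ?_
    rw [integral_atomUniformDist (by linarith) (hm j)]
    ring
  rw [hsum, add_assoc]
  gcongr
  have hd : 0 < p * XB - y := by linarith
  set u := y / (2 * XB * v i) with hu_def
  have hyu : y = u * (2 * XB * v i) := by rw [hu_def]; field_simp
  have h1 : p / (2 * XB * v i) * (y / (p * XB - y)) * (p * XB * (1 - v i)) =
      p * u * (p * XB * (1 - v i)) / (p * XB - y) := by
    rw [hu_def]
    ring
  rw [h1, div_le_iff₀ hd]
  -- The excess over `p * u` is at most `p * u * y / (p * XB - y)`. The numerator is at most `2 * v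
  -- i * XB` and the denominator at least `p * XB / 2`, whence `4 * v i / p`.
  have h2 : 4 * v i / p * (p * XB - y) ≥ 2 * v i * XB := by
    have : 4 * v i / p * (p * XB - y) ≥ 4 * v i / p * (p * XB / 2) := by
      gcongr
      linarith
    refine this.trans' (le_of_eq ?_)
    field_simp
    ring
  have h3 : p * u * y ≤ 2 * v i * XB := by
    have : p * u ≤ 1 := mul_le_one₀ hp1 hu0 hu.le
    nlinarith
  have h4 : 0 ≤ p * u * (p * XB * v i) := by positivity
  nlinarith

namespace Game

variable {n : ℕ} {XA XB : ℝ} (G : Game n XA XB)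

theorem XB_pos (G : Game n XA XB) : 0 < XB := G.XA_pos.trans_le G.XA_le_XB

theorem WA_pos : 0 < G.WA := by
  have : Nonempty (Fin n) := ⟨⟨0, by have := G.three_le; omega⟩⟩
  exact Finset.sum_pos (fun i _ => G.wA_pos i) Finset.univ_nonempty

theorem vA_pos (i : Fin n) : 0 < G.vA i := div_pos (G.wA_pos i) G.WA_pos

theorem sum_vA : ∑ i, G.vA i = 1 := by
  simp only [vA]
  rw [← Finset.sum_div]
  exact div_self G.WA_pos.ne'

theorem vA_mul_WA (i : Fin n) : G.WA * G.vA i = G.wA i := mul_div_cancel₀ _ G.WA_pos.ne'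

theorem vA_le {wlo whi : ℝ} (hwlo : 0 < wlo) (hG : G.ValuesIn wlo whi) (i : Fin n) :
    G.vA i ≤ whi / (n * wlo) := by
  have hn : 0 < (n : ℝ) := by have := G.three_le; positivity
  have hW : n * wlo ≤ G.WA := by
    have := Finset.card_nsmul_le_sum Finset.univ G.wA wlo fun i _ => (hG i).1.1
    rw [WA]
    simpa using this
  exact div_le_div₀ ((G.wA_pos i).le.trans (hG i).1.2) (hG i).1.2 (by positivity) hW

/-! ### Common values: the multiplier and the marginals -/

section ConstantSum

variable {G}

theorem IsConstantSum.WB_eq (hc : G.IsConstantSum) :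
    G.WB = G.WA := (Finset.sum_congr rfl fun i _ => hc i).symm

theorem IsConstantSum.W_eq (hc : G.IsConstantSum) : G.W = G.WA := by rw [W, hc.WB_eq, max_self]

theorem IsConstantSum.vB_eq (hc : G.IsConstantSum)
    (i : Fin n) : G.vB i = G.vA i := by rw [vA, vB, hc.WB_eq, hc i]

theorem IsConstantSum.OmegaA_of_lt (hc : G.IsConstantSum)
    {γ : ℝ} (hγ : γ < 1) : G.OmegaA γ = Finset.univ := by
  refine Finset.filter_true_of_mem fun i _ => ?_
  rwa [hc.vB_eq, div_self (G.vA_pos i).ne']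

theorem IsConstantSum.OmegaA_of_le (hc : G.IsConstantSum)
    {γ : ℝ} (hγ : 1 ≤ γ) : G.OmegaA γ = ∅ := by
  refine Finset.filter_false_of_mem fun i _ => ?_
  rwa [hc.vB_eq, div_self (G.vA_pos i).ne', not_lt]

theorem IsConstantSum.sum_vA_sq_div_vB (hc : G.IsConstantSum) : ∑ i, G.vA i ^ 2 / G.vB i = 1 := by
  rw [← G.sum_vA]
  refine Finset.sum_congr rfl fun i _ => ?_
  rw [hc.vB_eq, sq, mul_self_div_self]

theorem IsConstantSum.sum_vB_sq_div_vA (hc : G.IsConstantSum) : ∑ i, G.vB i ^ 2 / G.vA i = 1 := by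
  rw [← G.sum_vA]
  refine Finset.sum_congr rfl fun i _ => ?_
  rw [hc.vB_eq, sq, mul_self_div_self]

theorem IsConstantSum.solutionSet_eq (hc : G.IsConstantSum) : G.solutionSet = {XB / XA} := by
  have hA := G.XA_pos
  have hratio : 1 ≤ XB / XA := (one_le_div hA).2 G.XA_le_XB
  have hvB : ∑ i, G.vB i = 1 := by simp only [hc.vB_eq, G.sum_vA]
  ext γ
  rw [Set.mem_singleton_iff]
  rcases lt_or_ge γ 1 with hγ | hγ
  -- Both sides are false here: the equation would give `γ = XB / XA`, which is at least 1.
  · refine ⟨fun h => ?_, fun h => absurd hγ (by rw [h]; exact not_lt.2 hratio)⟩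
    obtain ⟨h0, h⟩ := h
    simp only [hc.OmegaA_of_lt hγ, hc.sum_vB_sq_div_vA, hvB, Finset.compl_univ,
      Finset.sum_empty, mul_one, mul_zero, add_zero, div_one] at h
    rw [mul_div_right_comm, sq] at h
    exact (mul_right_cancel₀ h0.ne' h).symm
  · have h0 : 0 < γ := by linarith
    have hmem : γ ∈ G.solutionSet ↔ XB / XA * γ = γ * γ := by
      simp only [solutionSet, Set.mem_ofPred_eq, h0, true_and, hc.OmegaA_of_le hγ,
        Finset.compl_empty, hc.sum_vA_sq_div_vB, G.sum_vA, Finset.sum_empty, mul_one, mul_zero,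
        zero_add, one_div_one_div]
      rw [mul_div_right_comm, sq]
    rw [hmem]
    exact ⟨fun h => (mul_right_cancel₀ h0.ne' h).symm, fun h => by rw [h]⟩

theorem IsConstantSum.lambdaA_eq (hc : G.IsConstantSum) : G.lambdaA (XB / XA) = 1 / (2 * XB) := by
  have hratio : 1 ≤ XB / XA := (one_le_div G.XA_pos).2 G.XA_le_XB
  simp [lambdaA, hc.OmegaA_of_le hratio, G.sum_vA]

theorem IsConstantSum.lambdaB_eq (hc : G.IsConstantSum) :
    G.lambdaB (XB / XA) = XA / (2 * XB ^ 2) := by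
  have hratio : 1 ≤ XB / XA := (one_le_div G.XA_pos).2 G.XA_le_XB
  have hA := G.XA_pos
  have hB := G.XB_pos
  rw [lambdaB, hc.OmegaA_of_le hratio, Finset.compl_empty, hc.sum_vA_sq_div_vB]
  field_simp
  simp

theorem IsConstantSum.distA_eq (hc : G.IsConstantSum) :
    G.distA (XB / XA) = fun i => atomUniformDist (1 - XA / XB) (2 * XB * G.vA i) := by
  have hratio : 1 ≤ XB / XA := (one_le_div G.XA_pos).2 G.XA_le_XB
  have hA := G.XA_pos
  have hB := G.XB_pos
  ext1 i
  have hv := G.vA_pos i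
  rw [distA, hc.OmegaA_of_le hratio, if_neg (Finset.notMem_empty i), hc.lambdaA_eq,
    hc.lambdaB_eq, hc.vB_eq]
  congr 1 <;> field_simp

/-- The weight `1 - 1` is left unsimplified so that B's law is the case `p = 1` of A's family and
one estimate serves both. -/
theorem IsConstantSum.distB_eq (hc : G.IsConstantSum) :
    G.distB (XB / XA) = fun i => atomUniformDist (1 - 1) (2 * XB * G.vA i) := by
  have hratio : 1 ≤ XB / XA := (one_le_div G.XA_pos).2 G.XA_le_XB
  ext1 i
  rw [distB, hc.OmegaA_of_le hratio, if_neg (Finset.notMem_empty i), hc.lambdaA_eq, sub_self,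
    atomUniformDist_zero]
  congr 1
  rw [div_div_eq_mul_div, div_one, mul_comm]

theorem IsConstantSum.IUA_eq (hc : G.IsConstantSum) : G.IUA (XB / XA) =
    (Measure.pi fun i => atomUniformDist (1 - XA / XB) (2 * XB * G.vA i)).map
      (rescale (XA / XB * XB)) := by
  rw [IUA, hc.distA_eq, div_mul_cancel₀ _ G.XB_pos.ne']

theorem IsConstantSum.IUB_eq (hc : G.IsConstantSum) : G.IUB (XB / XA) =
    (Measure.pi fun i => atomUniformDist (1 - 1) (2 * XB * G.vA i)).map (rescale (1 * XB)) := by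
  rw [IUB, hc.distB_eq, one_mul]

theorem IsConstantSum.payoffB_eq (hc : G.IsConstantSum) (x y : Fin n → ℝ) :
    G.payoffB x y = G.WA - G.payoffA x y := by
  rw [payoffA, payoffB, WA, ← Finset.sum_sub_distrib]
  refine Finset.sum_congr rfl fun i _ => ?_
  rw [← hc i, betaA, betaB]
  rcases lt_trichotomy (x i) (y i) with h | h | h
  · simp [h, h.not_gt, h.ne]
  · simp [h]
    ring
  · simp [h, h.not_gt, h.ne]

end ConstantSum

/-! ### Payoffs bounded by marginal distribution functions -/

theorem betaA_nonneg (x y : ℝ) : 0 ≤ G.betaA x y := by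
  have := G.α_nonneg
  unfold betaA
  split_ifs <;> linarith

theorem betaA_le_one (x y : ℝ) : G.betaA x y ≤ 1 := by
  have := G.α_le_one
  unfold betaA
  split_ifs <;> linarith

theorem payoffA_nonneg (x y : Fin n → ℝ) : 0 ≤ G.payoffA x y :=
  Finset.sum_nonneg fun i _ => mul_nonneg (G.wA_pos i).le (G.betaA_nonneg _ _)

theorem payoffA_le (x y : Fin n → ℝ) : G.payoffA x y ≤ G.WA :=
  Finset.sum_le_sum fun i _ => mul_le_of_le_one_right (G.wA_pos i).le (G.betaA_le_one _ _)

theorem measurable_betaA : Measurable fun p : ℝ × ℝ => G.betaA p.1 p.2 :=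
  Measurable.ite (measurableSet_lt measurable_snd measurable_fst) measurable_const
    (Measurable.ite (measurableSet_eq_fun measurable_fst measurable_snd) measurable_const
      measurable_const)

theorem measurable_payoffA :
    Measurable fun p : (Fin n → ℝ) × (Fin n → ℝ) => G.payoffA p.1 p.2 := by
  refine Finset.measurable_fun_sum _ fun i _ => measurable_const.mul ?_
  exact G.measurable_betaA.comp (f := fun p : (Fin n → ℝ) × (Fin n → ℝ) => (p.1 i, p.2 i))
    (by fun_prop)

theorem integrable_payoffA (μ : Measure ((Fin n → ℝ) × (Fin n → ℝ))) [IsFiniteMeasure μ] :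
    Integrable (fun p => G.payoffA p.1 p.2) μ := by
  refine Integrable.of_bound G.measurable_payoffA.aestronglyMeasurable G.WA
    (.of_forall fun p => ?_)
  rw [Real.norm_eq_abs, abs_of_nonneg (G.payoffA_nonneg _ _)]
  exact G.payoffA_le _ _

theorem mixedPayoffA_nonneg (s t : Measure (Fin n → ℝ)) : 0 ≤ G.mixedPayoffA s t :=
  integral_nonneg fun _ => G.payoffA_nonneg _ _

theorem IsConstantSum.mixedPayoffB_eq {G : Game n XA XB} (hc : G.IsConstantSum)
    (s t : Measure (Fin n → ℝ)) [IsProbabilityMeasure s] [IsProbabilityMeasure t] :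
    G.mixedPayoffB s t = G.WA - G.mixedPayoffA s t := by
  simp only [mixedPayoffB, mixedPayoffA, hc.payoffB_eq]
  rw [integral_sub (integrable_const _) (G.integrable_payoffA _)]
  simp

theorem IsConstantSum.mixedPayoffB_nonneg {G : Game n XA XB} (hc : G.IsConstantSum)
    (s t : Measure (Fin n → ℝ)) : 0 ≤ G.mixedPayoffB s t :=
  integral_nonneg fun _ => by
    rw [Pi.zero_apply, hc.payoffB_eq, sub_nonneg]
    exact G.payoffA_le _ _

theorem integrable_betaA {Ω : Type*} [MeasurableSpace Ω] (μ : Measure Ω) [IsFiniteMeasure μ]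
    {f g : Ω → ℝ} (hf : Measurable f) (hg : Measurable g) :
    Integrable (fun ω => G.betaA (f ω) (g ω)) μ := by
  refine Integrable.of_bound
    (G.measurable_betaA.comp (hf.prodMk hg)).aestronglyMeasurable 1 (.of_forall fun p => ?_)
  rw [Real.norm_eq_abs, abs_of_nonneg (G.betaA_nonneg _ _)]
  exact G.betaA_le_one _ _

theorem integral_betaA_ge (s : Measure (Fin n → ℝ)) [IsProbabilityMeasure s] (i : Fin n)
    (y : ℝ) : 1 - s.real {x | x i ≤ y} ≤ ∫ x, G.betaA (x i) y ∂s := by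
  have hs : MeasurableSet {x : Fin n → ℝ | x i ≤ y} :=
    measurableSet_le (measurable_pi_apply i) measurable_const
  rw [← probReal_compl_eq_one_sub hs, ← integral_indicator_one hs.compl]
  refine integral_mono ((integrable_const _).indicator hs.compl)
    (G.integrable_betaA s (measurable_pi_apply i) measurable_const) fun x => ?_
  refine Set.indicator_le' (g := fun x : Fin n → ℝ => G.betaA (x i) y) (fun x hx => ?_)
    (fun x _ => G.betaA_nonneg _ _) x
  have hx' : y < x i := not_le.1 hx
  simp [betaA, hx']

theorem integral_betaA_le (t : Measure (Fin n → ℝ)) [IsProbabilityMeasure t] (i : Fin n)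
    (x : ℝ) : ∫ y, G.betaA x (y i) ∂t ≤ t.real {y | y i ≤ x} := by
  have hs : MeasurableSet {y : Fin n → ℝ | y i ≤ x} :=
    measurableSet_le (measurable_pi_apply i) measurable_const
  rw [← integral_indicator_one hs]
  refine integral_mono (G.integrable_betaA t measurable_const (measurable_pi_apply i))
    ((integrable_const _).indicator hs) fun y => ?_
  refine Set.le_indicator (f := fun y : Fin n → ℝ => G.betaA x (y i))
    (fun y _ => G.betaA_le_one _ _) (fun y hy => ?_) y
  have hy' : x < y i := not_le.1 hy
  simp [betaA, hy'.not_gt, hy'.ne]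

/-- By Fubini it suffices to treat pure strategies of the opponent. Every tie is conceded by A here,
and awarded to A in `mixedPayoffA_le`, so `α` disappears and only marginals remain. -/
theorem le_mixedPayoffA {s t : Measure (Fin n → ℝ)} [IsProbabilityMeasure s]
    (ht : t ∈ mixedStrategies n XB) {c : ℝ}
    (h : ∀ y ∈ pureStrategies n XB, c ≤ ∑ i, G.wA i * (1 - s.real {x | x i ≤ y i})) :
    c ≤ G.mixedPayoffA s t := by
  obtain ⟨_, hty⟩ := ht
  have hint := G.integrable_payoffA (s.prod t)
  rw [mixedPayoffA, integral_prod_symm _ hint]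
  calc c = ∫ _, c ∂t := by simp
    _ ≤ _ := by
      refine integral_mono_ae (integrable_const _) hint.integral_prod_right ?_
      filter_upwards [hty] with y hy
      refine (h y hy).trans ?_
      simp only [payoffA]
      rw [integral_finsetSum _ fun i _ =>
        (G.integrable_betaA s (measurable_pi_apply i) measurable_const).const_mul _]
      refine Finset.sum_le_sum fun i _ => ?_
      rw [integral_const_mul]
      exact mul_le_mul_of_nonneg_left (G.integral_betaA_ge s i _) (G.wA_pos i).le

theorem mixedPayoffA_le {s t : Measure (Fin n → ℝ)} [IsProbabilityMeasure t]
    (hs : s ∈ mixedStrategies n XA) {c : ℝ}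
    (h : ∀ x ∈ pureStrategies n XA, ∑ i, G.wA i * t.real {y | y i ≤ x i} ≤ c) :
    G.mixedPayoffA s t ≤ c := by
  obtain ⟨_, hsx⟩ := hs
  have hint := G.integrable_payoffA (s.prod t)
  rw [mixedPayoffA, integral_prod _ hint]
  calc _ ≤ ∫ _, c ∂s := by
        refine integral_mono_ae hint.integral_prod_left (integrable_const _) ?_
        filter_upwards [hsx] with x hx
        refine le_trans ?_ (h x hx)
        simp only [payoffA]
        rw [integral_finsetSum _ fun i _ =>
          (G.integrable_betaA t measurable_const (measurable_pi_apply i)).const_mul _]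
        refine Finset.sum_le_sum fun i _ => ?_
        rw [integral_const_mul]
        exact mul_le_mul_of_nonneg_left (G.integral_betaA_le t i _) (G.wA_pos i).le
    _ = c := by simp

/-- The uniform ranges are proportional to the values, so the weights cancel and only the total
allocation survives. -/
theorem sum_wA_mul_div (y : Fin n → ℝ) :
    ∑ i, G.wA i * (y i / (2 * XB * G.vA i)) = G.WA * (∑ i, y i) / (2 * XB) := by
  rw [Finset.mul_sum, Finset.sum_div]
  refine Finset.sum_congr rfl fun i _ => ?_
  have hv := G.vA_pos i
  have hB := G.XB_pos
  rw [← G.vA_mul_WA]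
  field_simp

theorem sum_wA_mul_vA_le {d : ℝ} (hd : ∀ i, G.vA i ≤ d) : ∑ i, G.wA i * G.vA i ≤ G.WA * d := by
  rw [WA, Finset.sum_mul]
  exact Finset.sum_le_sum fun i _ => mul_le_mul_of_nonneg_left (hd i) (G.wA_pos i).le

/-! ### Guarantees of the two strategies and approximate optimality -/

section ApproximateOptimality

variable {G}

theorem IsConstantSum.IUA_mem_mixedStrategies (hc : G.IsConstantSum) :
    G.IUA (XB / XA) ∈ mixedStrategies n XA := by
  have hB := G.XB_pos
  have hA := G.XA_pos
  have hm : ∀ i, 0 < 2 * XB * G.vA i := fun i => mul_pos (by positivity) (G.vA_pos i)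
  have hq : XA / XB ≤ 1 := (div_le_one hB).2 G.XA_le_XB
  have hq0 : 0 < XA / XB := div_pos hA hB
  have : ∀ i, IsProbabilityMeasure (atomUniformDist (1 - XA / XB) (2 * XB * G.vA i)) := fun i =>
    isProbabilityMeasure_atomUniformDist (by linarith) (by linarith) (hm i)
  rw [IUA, hc.distA_eq]
  exact map_rescale_mem_mixedStrategies hA.le fun i =>
    (ae_atomUniformDist_mem_Icc _ (hm i)).mono fun x hx => hx.1

theorem IsConstantSum.IUB_mem_mixedStrategies (hc : G.IsConstantSum) :
    G.IUB (XB / XA) ∈ mixedStrategies n XB := by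
  have hB := G.XB_pos
  have hm : ∀ i, 0 < 2 * XB * G.vA i := fun i => mul_pos (by positivity) (G.vA_pos i)
  have : ∀ i, IsProbabilityMeasure (atomUniformDist (1 - 1) (2 * XB * G.vA i)) := fun i =>
    isProbabilityMeasure_atomUniformDist (by norm_num) (by norm_num) (hm i)
  rw [IUB, hc.distB_eq]
  exact map_rescale_mem_mixedStrategies hB.le fun i =>
    (ae_atomUniformDist_mem_Icc _ (hm i)).mono fun x hx => hx.1

/-- The independently uniform strategy guarantees A almost `XA / (2 XB)` of the total value. -/
theorem IsConstantSum.le_mixedPayoffA_IUA (hc : G.IsConstantSum) {d : ℝ} (hd : ∀ i, G.vA i ≤ d)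
    {t : Measure (Fin n → ℝ)} (ht : t ∈ mixedStrategies n XB) :
    G.WA * (XA / (2 * XB) - 4 * d / (XA / XB)) ≤ G.mixedPayoffA (G.IUA (XB / XA)) t := by
  have hB := G.XB_pos
  have hA := G.XA_pos
  have hW := G.WA_pos
  have hq : XA / XB ≤ 1 := (div_le_one hB).2 G.XA_le_XB
  have hq0 : 0 < XA / XB := div_pos hA hB
  have := hc.IUA_mem_mixedStrategies.1
  refine G.le_mixedPayoffA ht fun y hy => ?_
  have hterm : ∀ i, G.wA i * (XA / XB) - XA / XB * (G.wA i * (y i / (2 * XB * G.vA i))) -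
      4 / (XA / XB) * (G.wA i * G.vA i) ≤
      G.wA i * (1 - (G.IUA (XB / XA)).real {x | x i ≤ y i}) := by
    intro i
    have h := map_rescale_atomUniformDist_real_le G.vA_pos G.sum_vA hq0 hq hB i (hy.1 i)
    rw [← hc.IUA_eq] at h
    have h' := mul_le_mul_of_nonneg_left h (G.wA_pos i).le
    refine le_trans (le_of_eq ?_) ((sub_le_sub_left h' (G.wA i)).trans (le_of_eq (by ring)))
    ring
  refine le_trans ?_ (Finset.sum_le_sum fun i _ => hterm i)
  rw [Finset.sum_sub_distrib, Finset.sum_sub_distrib, ← Finset.sum_mul, ← Finset.mul_sum,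
    ← Finset.mul_sum, G.sum_wA_mul_div]
  have h1 : XA / XB * (G.WA * (∑ i, y i) / (2 * XB)) ≤ XA / XB * (G.WA * XB / (2 * XB)) := by
    gcongr
    exact hy.2
  have h2 : 4 / (XA / XB) * ∑ i, G.wA i * G.vA i ≤ 4 / (XA / XB) * (G.WA * d) := by
    gcongr
    exact G.sum_wA_mul_vA_le hd
  have h3 : G.WA * (XA / (2 * XB) - 4 * d / (XA / XB)) =
      G.WA * (XA / XB) - XA / XB * (G.WA * XB / (2 * XB)) - 4 / (XA / XB) * (G.WA * d) := by
    field_simp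
    ring
  rw [h3]
  exact sub_le_sub (sub_le_sub_left h1 _) h2

/-- Against the independently uniform strategy of B, player A gains at most about
`XA / (2 XB)` of the total value. -/
theorem IsConstantSum.mixedPayoffA_IUB_le (hc : G.IsConstantSum) {d : ℝ} (hd : ∀ i, G.vA i ≤ d)
    {s : Measure (Fin n → ℝ)} (hs : s ∈ mixedStrategies n XA) :
    G.mixedPayoffA s (G.IUB (XB / XA)) ≤ G.WA * (XA / (2 * XB) + 4 * d / (XA / XB)) := by
  have hB := G.XB_pos
  have hA := G.XA_pos
  have hW := G.WA_pos
  have hq : XA / XB ≤ 1 := (div_le_one hB).2 G.XA_le_XB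
  have hq0 : 0 < XA / XB := div_pos hA hB
  have := hc.IUB_mem_mixedStrategies.1
  refine G.mixedPayoffA_le hs fun x hx => ?_
  have hterm : ∀ i, G.wA i * (G.IUB (XB / XA)).real {y | y i ≤ x i} ≤
      G.wA i * (x i / (2 * XB * G.vA i)) + 4 / (XA / XB) * (G.wA i * G.vA i) := by
    intro i
    have h := map_rescale_atomUniformDist_real_le G.vA_pos G.sum_vA one_pos le_rfl hB i (hx.1 i)
    rw [← hc.IUB_eq] at h
    have hv := G.vA_pos i
    -- B's own error, with `p = 1`, is weakened to A's so that both guarantees share one error term.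
    have h4 : 4 * G.vA i / 1 ≤ 4 * G.vA i / (XA / XB) := by gcongr
    have h' := mul_le_mul_of_nonneg_left (h.trans (add_le_add_right h4 _)) (G.wA_pos i).le
    refine h'.trans (le_of_eq ?_)
    ring
  refine (Finset.sum_le_sum fun i _ => hterm i).trans ?_
  rw [Finset.sum_add_distrib, ← Finset.mul_sum, G.sum_wA_mul_div]
  have h1 : G.WA * (∑ i, x i) / (2 * XB) ≤ G.WA * XA / (2 * XB) := by
    gcongr
    exact hx.2
  have h2 : 4 / (XA / XB) * ∑ i, G.wA i * G.vA i ≤ 4 / (XA / XB) * (G.WA * d) := by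
    gcongr
    exact G.sum_wA_mul_vA_le hd
  refine (add_le_add h1 h2).trans (le_of_eq ?_)
  ring

/-- Testing `s` against B's strategy bounds its worst case above, and A's guarantee bounds the other
worst case below. The leading terms cancel and the two errors `4 * d / (XA / XB)` add up. -/
theorem IsConstantSum.worstCaseA_le (hc : G.IsConstantSum) {d : ℝ} (hd : ∀ i, G.vA i ≤ d)
    {s : Measure (Fin n → ℝ)} (hs : s ∈ mixedStrategies n XA) :
    G.worstCaseA s ≤ G.worstCaseA (G.IUA (XB / XA)) + 8 * d / (XA / XB) * G.W := by
  have : Nonempty (mixedStrategies n XB) := ⟨⟨_, hc.IUB_mem_mixedStrategies⟩⟩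
  have hup : G.worstCaseA s ≤ G.WA * (XA / (2 * XB) + 4 * d / (XA / XB)) :=
    -- A real-valued `⨅` is a genuine lower bound only for a family bounded below; nonnegative
    -- payoffs supply the bound 0.
    (ciInf_le ⟨0, by rintro _ ⟨t, rfl⟩; exact G.mixedPayoffA_nonneg _ _⟩
      ⟨_, hc.IUB_mem_mixedStrategies⟩).trans (hc.mixedPayoffA_IUB_le hd hs)
  have hlo : G.WA * (XA / (2 * XB) - 4 * d / (XA / XB)) ≤ G.worstCaseA (G.IUA (XB / XA)) :=
    le_ciInf fun t => hc.le_mixedPayoffA_IUA hd t.2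
  rw [hc.W_eq]
  linear_combination hup + hlo

theorem IsConstantSum.worstCaseB_le (hc : G.IsConstantSum) {d : ℝ} (hd : ∀ i, G.vA i ≤ d)
    {t : Measure (Fin n → ℝ)} (ht : t ∈ mixedStrategies n XB) :
    G.worstCaseB t ≤ G.worstCaseB (G.IUB (XB / XA)) + 8 * d / (XA / XB) * G.W := by
  have : Nonempty (mixedStrategies n XA) := ⟨⟨_, hc.IUA_mem_mixedStrategies⟩⟩
  have := hc.IUA_mem_mixedStrategies.1
  have := hc.IUB_mem_mixedStrategies.1
  have := ht.1
  have hup : G.worstCaseB t ≤ G.WA - G.WA * (XA / (2 * XB) - 4 * d / (XA / XB)) := by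
    refine (ciInf_le ⟨0, by rintro _ ⟨s, rfl⟩; exact hc.mixedPayoffB_nonneg _ _⟩
      ⟨_, hc.IUA_mem_mixedStrategies⟩).trans ?_
    rw [hc.mixedPayoffB_eq]
    exact sub_le_sub_left (hc.le_mixedPayoffA_IUA hd ht) _
  have hlo : G.WA - G.WA * (XA / (2 * XB) + 4 * d / (XA / XB)) ≤
      G.worstCaseB (G.IUB (XB / XA)) := by
    refine le_ciInf fun s => ?_
    have := s.2.1
    rw [hc.mixedPayoffB_eq]
    exact sub_le_sub_left (hc.mixedPayoffA_IUB_le hd s.2) _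
  rw [hc.W_eq]
  linear_combination hup + hlo

end ApproximateOptimality

end Game

/-! ### The rate and the conclusion -/

theorem isSoftO_div_succ (C : ℝ) :
    IsSoftO (fun n => C / (n + 1)) (fun n => (n : ℝ) ^ (-(1 / 2) : ℝ)) := by
  refine ⟨0, Asymptotics.IsBigO.of_bound |C| ?_⟩
  filter_upwards [Filter.eventually_ge_atTop 1] with n hn
  have hn1 : (1 : ℝ) ≤ n := by exact_mod_cast hn
  have hpos : 0 < (n : ℝ) ^ (-(1 / 2) : ℝ) := Real.rpow_pos_of_pos (by linarith) _
  rw [pow_zero, mul_one, norm_div, Real.norm_eq_abs, Real.norm_eq_abs, Real.norm_eq_abs,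
    abs_of_pos hpos, abs_of_pos (by linarith : (0 : ℝ) < n + 1), div_eq_mul_inv]
  gcongr
  calc ((n : ℝ) + 1)⁻¹ ≤ (n : ℝ)⁻¹ := by gcongr; linarith
    _ = (n : ℝ) ^ (-1 : ℝ) := (Real.rpow_neg_one _).symm
    _ ≤ (n : ℝ) ^ (-(1 / 2) : ℝ) := Real.rpow_le_rpow_of_exponent_le hn1 (by norm_num)

end ColonelBlotto

theorem mainTheorem4 (XA XB wlo whi : ℝ) (hXA : 0 < XA) (hXAB : XA ≤ XB)
    (hwlo : 0 < wlo) (hwhi : 0 < whi) :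
    ∃ ε : ℕ → ℝ, (∀ n, 0 < ε n) ∧
      ColonelBlotto.IsSoftO ε (fun n => (n : ℝ) ^ (-(1 / 2) : ℝ)) ∧
      ∀ (n : ℕ) (G : ColonelBlotto.Game n XA XB), G.IsConstantSum → G.ValuesIn wlo whi →
        G.solutionSet = {XB / XA} ∧
        ∀ γ ∈ G.solutionSet,
          G.IUA γ ∈ ColonelBlotto.mixedStrategies n XA ∧
          G.IUB γ ∈ ColonelBlotto.mixedStrategies n XB ∧
          (∀ s ∈ ColonelBlotto.mixedStrategies n XA,
            G.worstCaseA s ≤ G.worstCaseA (G.IUA γ) + ε n * G.W) ∧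
          (∀ t ∈ ColonelBlotto.mixedStrategies n XB,
            G.worstCaseB t ≤ G.worstCaseB (G.IUB γ) + ε n * G.W) := by
  have hXB : 0 < XB := hXA.trans_le hXAB
  -- The error is `8 * d / (XA / XB)` with `d = whi / (n * wlo)`. The denominator `n + 1` keeps `ε
  -- 0` positive, and `n + 1 ≤ 2 * n` turns 8 into 16.
  set C : ℝ := 16 * (whi / wlo) / (XA / XB) with hC
  have hC0 : 0 < C := by positivity
  refine ⟨fun n => C / (n + 1), fun n => by positivity, ColonelBlotto.isSoftO_div_succ C, ?_⟩
  intro n G hc hG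
  refine ⟨hc.solutionSet_eq, fun γ hγ => ?_⟩
  rw [hc.solutionSet_eq, Set.mem_singleton_iff] at hγ
  subst hγ
  have hn : (1 : ℝ) ≤ n := by exact_mod_cast le_trans (by norm_num) G.three_le
  have hn0 : (0 : ℝ) < n := by linarith
  have herr : 8 * (whi / (n * wlo)) / (XA / XB) ≤ C / (n + 1) := by
    have heq : 8 * (whi / (n * wlo)) / (XA / XB) = C / (2 * n) := by
      rw [hC]
      field_simp
      norm_num
    rw [heq]
    gcongr
    linarith
  have hW : 0 ≤ G.W := by
    rw [hc.W_eq]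
    exact G.WA_pos.le
  have herrW := mul_le_mul_of_nonneg_right herr hW
  have hd := G.vA_le hwlo hG
  exact ⟨hc.IUA_mem_mixedStrategies, hc.IUB_mem_mixedStrategies,
    fun s hs => (hc.worstCaseA_le hd hs).trans (by linarith),
    fun t ht => (hc.worstCaseB_le hd ht).trans (by linarith)⟩
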